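/- **Setting.** Consider a finite two-player zero-sum extensive-form game with chance and perfect recall: $\mathcal A$ is the finite set of all actions and chance outcomes, $\mathcal Z$ is the set of terminal histories, $r_1$ is the utility of player $1$ on $\mathcal Z$ and $r_2=-r_1$. $\mathcal S_i$ is the finite set of information states of player $i\in\{1,2\}$ (each a non-empty set of histories at which $i$ acts), and $A(s)$ is the set of actions available at $s$. Perfect recall means that all histories in an information state of player $i$ have the same sequence of preceding information states and actions of player $i$. For a profile $\sigma=(\sigma_1,\sigma_2)$ of behavioral strategies, $\eta^\sigma(h,z)$ is the probability of reaching $z$ from $h$ (zero if $z$ does not extend $h$), $\eta_i^\sigma$ and $\eta_{-i}^\sigma$ are the factors contributed by player $i$ and by everyone else (chance included), reach probabilities from the beginning of the game are written with one argument, and $u_i(\sigma)=\sum_{z\in\mathcal Z}\eta^\sigma(z)r_i(z)$. For $s\in\mathcal S_i$ and $a\in A(s)$ the counterfactual value and the instantaneous counterfactual regret are $$v_i^\sigma(s,a)=\sum_{h\in s}\sum_{z\in\mathcal Z}\eta_i^\sigma(ha,z)\,\eta_{-i}^\sigma(z)\,r_i(z),\qquad \rho_i^\sigma(s,a)=v_i^\sigma(s,a)-\sum_{a'\in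 A(s)}\sigma_i(s,a')v_i^\sigma(s,a').$$ Let $U$ be a real number with $|v_i^\sigma(s,a)|\le U$ for all $\sigma,i,s,a$. Let $\sigma^k=(\sigma_{1,k},\sigma_{2,k})$, $k=1,2,\dots$, be the profiles played, and $R_{i,k}(s)=\big(\sum_{j=1}^k\rho_i^{\sigma^j}(s,a)\big)_{a\in A(s)}$ the cumulative counterfactual regrets. Given a feature map $\varphi$ from pairs of an information state and an action to $\mathbb R^d$ and arbitrary functions $y_{i,k}:\mathbb R^d\to\mathbb R$ ($k\ge0$), put $\tilde R_{i,k}(s)=\big(y_{i,k}(\varphi(s,a))\big)_{a\in A(s)}$. Fix a temperature $\tau>0$. Player $i$ follows *$f$-RCFR with the exponential link* $f(x)_a=e^{x_a/\tau}$ if $\sigma_{i,k}(s)\propto f(\tilde R_{i,k-1}(s))$ for all $k\ge1$ and $s\in\mathcal S_i$. With $g(x)_a=e^{x_a/\tau}/\sum_b e^{x_b/\tau}$, let $$\epsilon_i(s)=\sum_{k=1}^t\big\|g(R_{i,k-1}(s))-g(\tilde R_{i,k-1}(s))\big\|_1,\qquad \varepsilon_{i,t}=\sum_{s\in\mathcal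 S_i}\Big(\frac1t\big(\tau\ln|A(s)|+2U\epsilon_i(s)\big)+\frac{2U^2}{\tau}\Big),$$ and let $R^{\mathrm{EXT}}_{i,t}=\max_{a^*}\sum_{k=1}^t\big(u_i(a^*,\sigma_{-i,k})-u_i(\sigma^k)\big)$, the maximum being over the pure strategies $a^*\in\prod_{s\in\mathcal S_i}A(s)$. **Statement.** Let $t\ge1$. 1. For each player $i$ who follows $f$-RCFR with the exponential link, $$\frac1t R^{\mathrm{EXT}}_{i,t}\le\varepsilon_{i,t}\qquad\text{and}\qquad \varepsilon_{i,t}\le|\mathcal S_i|\Big(\frac1t\big(\tau\ln|\mathcal A|+2U\epsilon_i^*\big)+\frac{2U^2}{\tau}\Big),$$ where $\epsilon_i^*=\max_{s\in\mathcal S_i}\epsilon_i(s)$ (if $\mathcal S_i=\emptyset$, the right-hand side is $0$). 2. If both players do so, then the profile $\bar\sigma^t=(\bar\sigma_{1,t},\bar\sigma_{2,t})$ of average sequence weight policies, $\bar\sigma_{i,t}(s)\propto\sum_{k=1}^t\sum_{h\in s}\eta_i^{\sigma^k}(h)\,\sigma_{i,k}(s)$, is an $(\varepsilon_{1,t}+\varepsilon_{2,t})$-Nash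 equilibrium: no player can gain more than $\varepsilon_{1,t}+\varepsilon_{2,t}$ by a unilateral deviation. 3. Any $M$ with $|r_1(z)|\le M$ for all $z\in\mathcal Z$ is a possible choice of $U$. -/

import Mathlib

/-- The actions that extend the history `h` within the set of histories `H`. -/
def available {𝒜 : Type*} [Fintype 𝒜] [DecidableEq 𝒜] (H : Finset (List 𝒜)) (h : List 𝒜) :
    Finset 𝒜 :=
  Finset.univ.filter fun a => h ++ [a] ∈ H

/-- A finite two-player zero-sum extensive-form game with chance. Histories are finite sequences
over `𝒜` (actions of the players and chance outcomes). The players are `0` and `1`, and `S i`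
is the (label) type of the information states of player `i`. The values of `turn`, `chance` and
`utility` on sequences other than the relevant histories play no role. -/
structure ZeroSumEFG (𝒜 : Type*) [Fintype 𝒜] [DecidableEq 𝒜] (S : Fin 2 → Type*) where
  /-- the set of histories -/
  hist : Finset (List 𝒜)
  nil_mem : [] ∈ hist
  prefix_mem : ∀ h a, h ++ [a] ∈ hist → h ∈ hist
  /-- At a non-terminal history, `none` if chance acts there, and `some ⟨i, s⟩` if player `i` acts
  there and the history belongs to the information state `s` of player `i`. -/
  turn : List 𝒜 → Option (Σ i, S i)
  /-- every information state contains a history -/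
  info_nonempty : ∀ i s, ∃ h ∈ hist, (available hist h).Nonempty ∧ turn h = some ⟨i, s⟩
  /-- the set of actions `A(s)` at an information state -/
  acts : ∀ i, S i → Finset 𝒜
  /-- the histories of one information state all have the same available actions -/
  available_eq : ∀ i s, ∀ h ∈ hist, (available hist h).Nonempty → turn h = some ⟨i, s⟩ →
    available hist h = acts i s
  /-- the fixed policy of chance -/
  chance : List 𝒜 → 𝒜 → ℝ
  chance_nonneg : ∀ h ∈ hist, (available hist h).Nonempty → turn h = none →
    ∀ a ∈ available hist h, 0 ≤ chance h a
  chance_sum : ∀ h ∈ hist, (available hist h).Nonempty → turn h = none →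
    ∑ a ∈ available hist h, chance h a = 1
  /-- the utility of the first player at terminal histories -/
  utility : List 𝒜 → ℝ

theorem ZeroSumEFG.acts_nonempty {𝒜 : Type*} [Fintype 𝒜] [DecidableEq 𝒜] {S : Fin 2 → Type*}
    (G : ZeroSumEFG 𝒜 S) (i : Fin 2) (s : S i) : (G.acts i s).Nonempty := by
  obtain ⟨h, hh, hn, ht⟩ := G.info_nonempty i s
  exact G.available_eq i s h hh hn ht ▸ hn

namespace ZeroSumEFG

variable {𝒜 : Type*} [Fintype 𝒜] [DecidableEq 𝒜] {S : Fin 2 → Type*}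
  [∀ i, DecidableEq (S i)]

/-- The terminal histories. -/
def terminals (G : ZeroSumEFG 𝒜 S) : Finset (List 𝒜) :=
  G.hist.filter fun h => available G.hist h = ∅

/-- The utility function of player `i`; the game is zero-sum. -/
def reward (G : ZeroSumEFG 𝒜 S) (i : Fin 2) (z : List 𝒜) : ℝ :=
  if i = 0 then G.utility z else -G.utility z

/-- The information state `s` as a set of (non-terminal) histories. -/
def infoSet (G : ZeroSumEFG 𝒜 S) (i : Fin 2) (s : S i) : Finset (List 𝒜) :=
  G.hist.filter fun h => (available G.hist h).Nonempty ∧ G.turn h = some ⟨i, s⟩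

/-- The information states and actions of player `i` met when the actions `l` are played one after
the other starting at the history `h`. -/
def ownSeq (G : ZeroSumEFG 𝒜 S) (i : Fin 2) : List 𝒜 → List 𝒜 → List ((Σ i, S i) × 𝒜)
  | _, [] => []
  | h, a :: l =>
    (match G.turn h with
      | some s => if s.1 = i then [(s, a)] else []
      | none => []) ++ ownSeq G i (h ++ [a]) l

/-- Perfect recall: any two histories in an information state of player `i` have the same
sequence of preceding information states and actions of player `i`. -/
def PerfectRecall (G : ZeroSumEFG 𝒜 S) : Prop :=
  ∀ i s, ∀ h ∈ G.infoSet i s, ∀ h' ∈ G.infoSet i s, G.ownSeq i [] h = G.ownSeq i [] h'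

/-- Behavioral strategies of player `i`. -/
abbrev Policy (G : ZeroSumEFG 𝒜 S) (i : Fin 2) : Type _ :=
  ∀ s : S i, stdSimplex ℝ (G.acts i s)

/-- Joint policies. -/
abbrev Profile (G : ZeroSumEFG 𝒜 S) : Type _ := ∀ i, G.Policy i

/-- The probability that the acting player (or chance) chooses `a` at `h`. -/
def stepProb (G : ZeroSumEFG 𝒜 S) (σ : G.Profile) (h : List 𝒜) (a : 𝒜) : ℝ :=
  match G.turn h with
  | none => G.chance h a
  | some ⟨i, s⟩ => if ha : a ∈ G.acts i s then (σ i s).1 ⟨a, ha⟩ else 0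

/-- The contribution of player `i` to `stepProb`. -/
def ownStep (G : ZeroSumEFG 𝒜 S) (i : Fin 2) (σ : G.Profile) (h : List 𝒜) (a : 𝒜) : ℝ :=
  if (G.turn h).map Sigma.fst = some i then G.stepProb σ h a else 1

/-- The contribution of everyone except player `i` (including chance) to `stepProb`. -/
def otherStep (G : ZeroSumEFG 𝒜 S) (i : Fin 2) (σ : G.Profile) (h : List 𝒜) (a : 𝒜) : ℝ :=
  if (G.turn h).map Sigma.fst = some i then 1 else G.stepProb σ h a

/-- The product of the weights `w` of the successive moves when `l` is played starting at `h`. -/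
def pathProd (w : List 𝒜 → 𝒜 → ℝ) : List 𝒜 → List 𝒜 → ℝ
  | _, [] => 1
  | h, a :: l => w h a * pathProd w (h ++ [a]) l

/-- The probability, under the move weights `w`, of reaching `z` from `h`
(`0` if `z` does not extend `h`). -/
def reach (w : List 𝒜 → 𝒜 → ℝ) (h z : List 𝒜) : ℝ :=
  if h <+: z then pathProd w h (z.drop h.length) else 0

/-- The expected value of the profile `σ` to player `i`. -/
def value (G : ZeroSumEFG 𝒜 S) (i : Fin 2) (σ : G.Profile) : ℝ :=
  ∑ z ∈ G.terminals, reach (G.stepProb σ) [] z * G.reward i z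

/-- `σ` is an `ε`-Nash equilibrium: no player gains more than `ε` by a unilateral deviation. -/
def IsNash (G : ZeroSumEFG 𝒜 S) (σ : G.Profile) (ε : ℝ) : Prop :=
  ∀ (i : Fin 2) (π : G.Policy i), G.value i (Function.update σ i π) ≤ G.value i σ + ε

/-- The counterfactual value of playing `a` at the information state `s` of player `i`. -/
def cfValue (G : ZeroSumEFG 𝒜 S) (σ : G.Profile) (i : Fin 2) (s : S i) (a : G.acts i s) : ℝ :=
  ∑ h ∈ G.infoSet i s, ∑ z ∈ G.terminals,
    reach (G.ownStep i σ) (h ++ [a.1]) z * reach (G.otherStep i σ) [] z * G.reward i z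

/-- The instantaneous counterfactual regret. -/
def cfRegret (G : ZeroSumEFG 𝒜 S) (σ : G.Profile) (i : Fin 2) (s : S i) (a : G.acts i s) : ℝ :=
  G.cfValue σ i s a - ∑ b, (σ i s).1 b * G.cfValue σ i s b

/-- The cumulative counterfactual regrets at `s` after the iterations `1, …, k`, where `σ j` is the
profile played at iteration `j`. -/
def cumRegret (G : ZeroSumEFG 𝒜 S) (σ : ℕ → G.Profile) (k : ℕ) (i : Fin 2) (s : S i) :
    G.acts i s → ℝ :=
  fun a => ∑ j ∈ Finset.Icc 1 k, G.cfRegret (σ j) i s a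

/-- Pure strategies of player `i`. -/
abbrev Pure (G : ZeroSumEFG 𝒜 S) (i : Fin 2) : Type _ := ∀ s : S i, G.acts i s

/-- The policy that puts all mass on the choices of a pure strategy. -/
def Pure.toPolicy {G : ZeroSumEFG 𝒜 S} {i : Fin 2} (p : G.Pure i) : G.Policy i :=
  fun s => ⟨Pi.single (p s) 1, single_mem_stdSimplex ℝ (p s)⟩

/-- The cumulative external regret of player `i` after the iterations `1, …, t`
(a maximum over the finitely many pure strategies). -/
noncomputable def extRegret (G : ZeroSumEFG 𝒜 S) (σ : ℕ → G.Profile) (t : ℕ) (i : Fin 2) : ℝ :=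
  ⨆ p : G.Pure i, ∑ k ∈ Finset.Icc 1 t,
    (G.value i (Function.update (σ k) i p.toPolicy) - G.value i (σ k))

open Classical in
/-- The distribution proportional to the non-negative, non-zero vector `w`
(any distribution if `w` is not of this kind). -/
noncomputable def normalize {A : Type*} [Fintype A] [Nonempty A] (w : A → ℝ) : stdSimplex ℝ A :=
  if hw : (∀ a, 0 ≤ w a) ∧ 0 < ∑ a, w a then
    ⟨fun a => w a / ∑ b, w b, fun a => div_nonneg (hw.1 a) hw.2.le, by
      rw [← Finset.sum_div, div_self hw.2.ne']⟩
  else ⟨Pi.single (Classical.arbitrary A) 1, single_mem_stdSimplex ℝ _⟩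

/-- The profile of average sequence weight policies over the iterations `1, …, t`: at `s` it is
proportional to the sum over the iterations `k` and the histories `h ∈ s` of the own reach
probability of `h` under `σ k` times the policy of `σ k` at `s`. -/
noncomputable def avgProfile (G : ZeroSumEFG 𝒜 S) (σ : ℕ → G.Profile) (t : ℕ) : G.Profile :=
  fun i s =>
    haveI : Nonempty (G.acts i s) := (G.acts_nonempty i s).to_subtype
    normalize fun a => ∑ k ∈ Finset.Icc 1 t, ∑ h ∈ G.infoSet i s,
      reach (G.ownStep i (σ k)) [] h * (σ k i s).1 a

end ZeroSumEFG

/-- The exponential link function with temperature `τ`. -/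
noncomputable def expLink {A : Type*} (τ : ℝ) (x : A → ℝ) : A → ℝ :=
  fun a => Real.exp (1 / τ * x a)

/-- The normalized exponential link function (softmax with temperature `τ`). -/
noncomputable def softmax {A : Type*} [Fintype A] (τ : ℝ) (x : A → ℝ) : A → ℝ :=
  fun a => Real.exp (1 / τ * x a) / ∑ b, Real.exp (1 / τ * x b)

namespace ZeroSumEFG

variable {𝒜 : Type*} [Fintype 𝒜] [DecidableEq 𝒜] {S : Fin 2 → Type*}
  [∀ i, DecidableEq (S i)]

/-- The regrets at `s` predicted by the function approximator `y` from the features `φ`. -/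
def estRegret (G : ZeroSumEFG 𝒜 S) {d : ℕ} (φ : (Σ i, S i) → 𝒜 → EuclideanSpace ℝ (Fin d))
    (y : EuclideanSpace ℝ (Fin d) → ℝ) (i : Fin 2) (s : S i) : G.acts i s → ℝ :=
  fun a => y (φ ⟨i, s⟩ a.1)

/-- Player `i` follows `f`-RCFR with the exponential link `f`: at every iteration `k ≥ 1` the policy
at each of the player's information states is proportional to the link of the regrets predicted by
the current function approximator `y (k - 1)`, the estimate of the cumulative regrets after `k - 1`
iterations. -/
def IsExpRCFR (G : ZeroSumEFG 𝒜 S) (τ : ℝ) {d : ℕ}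
    (φ : (Σ i, S i) → 𝒜 → EuclideanSpace ℝ (Fin d)) (y : ℕ → EuclideanSpace ℝ (Fin d) → ℝ)
    (σ : ℕ → G.Profile) (i : Fin 2) : Prop :=
  ∀ k, 1 ≤ k → ∀ s : S i, ∃ c : ℝ, ∀ a,
    (σ k i s).1 a = c * expLink τ (G.estRegret φ (y (k - 1)) i s) a

/-- The cumulative approximation error `ϵ_i(s)` over `t` iterations. -/
noncomputable def approxError (G : ZeroSumEFG 𝒜 S) (τ : ℝ) {d : ℕ}
    (φ : (Σ i, S i) → 𝒜 → EuclideanSpace ℝ (Fin d)) (y : ℕ → EuclideanSpace ℝ (Fin d) → ℝ)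
    (σ : ℕ → G.Profile) (t : ℕ) (i : Fin 2) (s : S i) : ℝ :=
  ∑ k ∈ Finset.Icc 1 t, ∑ a,
    |softmax τ (G.cumRegret σ (k - 1) i s) a - softmax τ (G.estRegret φ (y (k - 1)) i s) a|

/-- The regret bound `ε_{i,t}`. -/
noncomputable def regretBound [∀ i, Fintype (S i)] (G : ZeroSumEFG 𝒜 S) (U τ : ℝ) {d : ℕ}
    (φ : (Σ i, S i) → 𝒜 → EuclideanSpace ℝ (Fin d)) (y : ℕ → EuclideanSpace ℝ (Fin d) → ℝ)
    (σ : ℕ → G.Profile) (t : ℕ) (i : Fin 2) : ℝ :=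
  ∑ s : S i, (1 / (t : ℝ) * (τ * Real.log (G.acts i s).card +
    2 * U * G.approxError τ φ y σ t i s) + 2 * U ^ 2 / τ)

end ZeroSumEFG

/-! The proof has three layers: a regret bound for one decision, a decomposition of the regret in
the game tree, and the passage from regret to equilibrium.

For one decision, the potential `softMaximum` (`τ` times log-sum-exp) dominates every cumulative
regret and starts at `τ ln |A|`. If the instantaneous regrets have oscillation at most `2U`, one
round raises it by at most their softmax mean plus `2U²/τ`, by Hoeffding's lemma
(`softMaximum_add_le`). Regrets have mean zero under the policy actually played, so their softmax
mean is at most `2U` times the l1 distance between the two distributions. Summation gives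
`cumulative_regret_le`.

In the tree, changing one player's moves one at a time writes the gain of a deviation as a
telescoping sum. Under perfect recall the deviator's own reach probability is constant on an
information state, so the sum collapses to counterfactual regrets with coefficients in `[0, 1]`
(`value_update_sub_value`). Bounding each state separately gives `average_gain_le`, for all
behavioral deviations.

The average policy realizes the average of the own reach probabilities (`pathProd_avgProfile`), so
values against it are averages over the iterations. Adding the two players' regret bounds in a
zero-sum game yields `isNash_avgProfile`. Finally, the weights in a counterfactual value are
dominated by a sub-probability on terminal histories, whence `abs_cfValue_le`. -/

section Hedge

/-! ### Exponential weights: the regret bound at a single decision. -/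

variable {A : Type*} [Fintype A]

/-- By convexity `exp` lies below its chord over `[-c, c]`. For `c = 0` the slope is the junk value
`0 / 0 = 0`, which is harmless because then `x = 0`. -/
theorem exp_le_cosh_add_mul_sinh_div {x c : ℝ} (h : |x| ≤ c) :
    Real.exp x ≤ Real.cosh c + x * (Real.sinh c / c) := by
  rcases (abs_nonneg x |>.trans h).eq_or_lt with hc | hc
  · subst hc
    have : x = 0 := abs_eq_zero.1 (le_antisymm h (abs_nonneg x))
    simp [this]
  · obtain ⟨h1, h2⟩ := abs_le.1 h
    have := convexOn_exp.2 (Set.mem_univ c) (Set.mem_univ (-c))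
      (show 0 ≤ (c + x) / (2 * c) from div_nonneg (by linarith) (by linarith))
      (show 0 ≤ (c - x) / (2 * c) from div_nonneg (by linarith) (by linarith))
      (by field_simp; ring)
    simp only [smul_eq_mul] at this
    have e : (c + x) / (2 * c) * c + (c - x) / (2 * c) * -c = x := by field_simp; ring
    rw [e] at this
    refine this.trans_eq ?_
    rw [Real.cosh_eq, Real.sinh_eq]
    field_simp
    ring

/-- Hoeffding's lemma for a symmetric range: the linear term of the chord averages to zero, leaving
`cosh c`. -/
theorem sum_mul_exp_le_of_mean_zero {p x : A → ℝ} {c : ℝ} (hp : ∀ a, 0 ≤ p a)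
    (hp1 : ∑ a, p a = 1) (hx : ∀ a, |x a| ≤ c) (h0 : ∑ a, p a * x a = 0) :
    ∑ a, p a * Real.exp (x a) ≤ Real.exp (c ^ 2 / 2) := by
  calc ∑ a, p a * Real.exp (x a)
      ≤ ∑ a, p a * (Real.cosh c + x a * (Real.sinh c / c)) :=
        Finset.sum_le_sum fun a _ =>
          mul_le_mul_of_nonneg_left (exp_le_cosh_add_mul_sinh_div (hx a)) (hp a)
    _ = (∑ a, p a) * Real.cosh c + (∑ a, p a * x a) * (Real.sinh c / c) := by
        rw [Finset.sum_mul, Finset.sum_mul, ← Finset.sum_add_distrib]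
        exact Finset.sum_congr rfl fun a _ => by ring
    _ = Real.cosh c := by rw [hp1, h0]; ring
    _ ≤ Real.exp (c ^ 2 / 2) := Real.cosh_le_exp_half_sq c

/-- The potential of the exponential link. -/
noncomputable def softMaximum (τ : ℝ) (x : A → ℝ) : ℝ :=
  τ * Real.log (∑ a, Real.exp (1 / τ * x a))

theorem softmax_nonneg (τ : ℝ) (x : A → ℝ) (a : A) : 0 ≤ softmax τ x a :=
  div_nonneg (Real.exp_nonneg _) (Finset.sum_nonneg fun _ _ => Real.exp_nonneg _)

theorem le_softMaximum {τ : ℝ} (hτ : 0 < τ) (x : A → ℝ) (a : A) : x a ≤ softMaximum τ x := by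
  have : 1 / τ * x a ≤ Real.log (∑ a, Real.exp (1 / τ * x a)) := by
    rw [← Real.log_exp (1 / τ * x a)]
    exact Real.log_le_log (Real.exp_pos _) (Finset.single_le_sum
      (f := fun a => Real.exp (1 / τ * x a)) (fun _ _ => Real.exp_nonneg _) (Finset.mem_univ a))
  calc x a = τ * (1 / τ * x a) := by field_simp
    _ ≤ _ := mul_le_mul_of_nonneg_left this hτ.le

theorem softMaximum_zero (τ : ℝ) :
    softMaximum τ (fun _ : A => 0) = τ * Real.log (Fintype.card A) := by
  simp [softMaximum]

variable [Nonempty A]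

theorem sum_exp_pos (x : A → ℝ) : 0 < ∑ a, Real.exp (x a) :=
  Finset.sum_pos (fun _ _ => Real.exp_pos _) Finset.univ_nonempty

theorem sum_softmax (τ : ℝ) (x : A → ℝ) : ∑ a, softmax τ x a = 1 := by
  simp only [softmax]
  rw [← Finset.sum_div, div_self (sum_exp_pos _).ne']

theorem eq_softmax_of_proportional {τ c : ℝ} {p x : A → ℝ} (hp : ∑ a, p a = 1)
    (h : ∀ a, p a = c * expLink τ x a) : p = softmax τ x := by
  have hs : c * ∑ a, Real.exp (1 / τ * x a) = 1 := by
    rw [Finset.mul_sum]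
    exact (Finset.sum_congr rfl fun a _ => (h a).symm).trans hp
  funext a
  rw [h a, softmax, expLink, eq_div_iff (sum_exp_pos _).ne', mul_right_comm, hs, one_mul]

/-- The increment of the potential is `τ` times the log of the mean of `exp (ρ / τ)` under the
softmax of `x`. Centring `ρ` at its mean `m` and applying Hoeffding's lemma with radius `c / τ`
leaves the error `τ (c / τ)² / 2`. -/
theorem softMaximum_add_le {τ c : ℝ} (hτ : 0 < τ) (x ρ : A → ℝ) (hρ : ∀ a b, |ρ a - ρ b| ≤ c) :
    softMaximum τ (fun a => x a + ρ a) ≤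
      softMaximum τ x + ∑ a, softmax τ x a * ρ a + c ^ 2 / (2 * τ) := by
  set p := softmax τ x with hp
  set m := ∑ a, p a * ρ a with hm
  have hp0 : ∀ a, 0 ≤ p a := softmax_nonneg τ x
  have hp1 : ∑ a, p a = 1 := sum_softmax τ x
  -- The mean is a convex combination of the values, so deviations from it are bounded by the
  -- oscillation.
  have hdev : ∀ a, ρ a - m = ∑ b, p b * (ρ a - ρ b) := fun a => by
    simp only [mul_sub, Finset.sum_sub_distrib, ← Finset.sum_mul, hp1, one_mul, hm]
  have hb : ∀ a, |1 / τ * (ρ a - m)| ≤ c / τ := fun a => by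
    rw [abs_mul, abs_of_pos (by positivity), one_div, inv_mul_eq_div]
    refine div_le_div_of_nonneg_right ?_ hτ.le
    rw [hdev]
    refine (Finset.abs_sum_le_sum_abs _ _).trans ?_
    calc ∑ b, |p b * (ρ a - ρ b)| ≤ ∑ b, p b * c := Finset.sum_le_sum fun b _ => by
          rw [abs_mul, abs_of_nonneg (hp0 b)]
          exact mul_le_mul_of_nonneg_left (hρ a b) (hp0 b)
      _ = c := by rw [← Finset.sum_mul, hp1, one_mul]
  have h0 : ∑ a, p a * (1 / τ * (ρ a - m)) = 0 := by
    have : ∀ a, p a * (1 / τ * (ρ a - m)) = 1 / τ * (p a * ρ a - p a * m) := fun a => by ring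
    rw [Finset.sum_congr rfl fun a _ => this a, ← Finset.mul_sum, Finset.sum_sub_distrib,
      ← Finset.sum_mul, hp1, ← hm]
    ring
  have key := sum_mul_exp_le_of_mean_zero hp0 hp1 hb h0
  set Z := ∑ a, Real.exp (1 / τ * x a) with hZ
  have hZp : 0 < Z := sum_exp_pos _
  have e : ∑ a, Real.exp (1 / τ * (x a + ρ a)) =
      Z * (Real.exp (m / τ) * ∑ a, p a * Real.exp (1 / τ * (ρ a - m))) := by
    rw [Finset.mul_sum, Finset.mul_sum]
    refine Finset.sum_congr rfl fun a _ => ?_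
    have : Real.exp (1 / τ * (x a + ρ a)) =
        Real.exp (1 / τ * x a) * (Real.exp (m / τ) * Real.exp (1 / τ * (ρ a - m))) := by
      rw [← Real.exp_add, ← Real.exp_add]
      congr 1
      ring
    rw [this, hp, softmax, ← hZ]
    field_simp
  have hlog : Real.log (∑ a, Real.exp (1 / τ * (x a + ρ a))) ≤
      Real.log Z + m / τ + (c / τ) ^ 2 / 2 := by
    rw [← Real.log_exp (Real.log Z + m / τ + (c / τ) ^ 2 / 2)]
    refine Real.log_le_log (sum_exp_pos _) ?_
    rw [e, Real.exp_add, Real.exp_add, Real.exp_log hZp, mul_assoc]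
    gcongr
  calc softMaximum τ (fun a => x a + ρ a) ≤ τ * (Real.log Z + m / τ + (c / τ) ^ 2 / 2) :=
        mul_le_mul_of_nonneg_left hlog hτ.le
    _ = _ := by rw [softMaximum, ← hZ]; field_simp

/-- Regret bound for playing `p k` instead of the softmax of the regrets cumulated so far. -/
theorem cumulative_regret_le {τ U : ℝ} (hτ : 0 < τ) (v p : ℕ → A → ℝ) (x : ℕ → A → ℝ)
    (hv : ∀ k a, |v k a| ≤ U) (hp0 : ∀ k a, 0 ≤ p k a) (hp1 : ∀ k, ∑ a, p k a = 1)
    (hx : ∀ k a, x k a = ∑ j ∈ Finset.Icc 1 k, (v j a - ∑ b, p j b * v j b)) (t : ℕ) (a : A) :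
    x t a ≤ τ * Real.log (Fintype.card A) +
      2 * U * (∑ k ∈ Finset.Icc 1 t, ∑ a, |softmax τ (x (k - 1)) a - p k a|) +
      t * (2 * U ^ 2 / τ) := by
  -- The induction runs on the potential, whose growth can be controlled in each round, rather than
  -- on a single coordinate.
  refine (le_softMaximum hτ (x t) a).trans ?_
  clear a
  induction t with
  | zero =>
    have : x 0 = fun _ => 0 := by funext a; simp [hx]
    rw [this, softMaximum_zero]
    simp
  | succ n ih =>
    set ρ : A → ℝ := fun a => v (n + 1) a - ∑ b, p (n + 1) b * v (n + 1) b with hρ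
    have hs : x (n + 1) = fun a => x n a + ρ a := by
      funext a
      rw [hx, hx, Finset.sum_Icc_succ_top (by omega)]
    have hosc : ∀ a b, |ρ a - ρ b| ≤ 2 * U := fun a b => by
      have : ρ a - ρ b = v (n + 1) a - v (n + 1) b := by simp [hρ]
      rw [this]
      exact (abs_sub _ _).trans (by linarith [hv (n + 1) a, hv (n + 1) b])
    have hz : ∑ a, p (n + 1) a * ρ a = 0 := by
      simp only [hρ, mul_sub, Finset.sum_sub_distrib, ← Finset.sum_mul, hp1, one_mul, sub_self]
    have hle : ∀ a, |ρ a| ≤ 2 * U := fun a => by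
      have : ρ a = ∑ b, p (n + 1) b * (ρ a - ρ b) := by
        simp only [mul_sub, Finset.sum_sub_distrib, ← Finset.sum_mul, hp1, one_mul, hz, sub_zero]
      rw [this]
      refine (Finset.abs_sum_le_sum_abs _ _).trans ?_
      calc ∑ b, |p (n + 1) b * (ρ a - ρ b)| ≤ ∑ b, p (n + 1) b * (2 * U) :=
            Finset.sum_le_sum fun b _ => by
              rw [abs_mul, abs_of_nonneg (hp0 _ b)]
              exact mul_le_mul_of_nonneg_left (hosc a b) (hp0 _ b)
        _ = 2 * U := by rw [← Finset.sum_mul, hp1, one_mul]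
    -- Subtracting the zero mean of `ρ` under `p (n + 1)` turns the softmax mean into the
    -- approximation error.
    have hin : ∑ a, softmax τ (x n) a * ρ a ≤
        2 * U * ∑ a, |softmax τ (x n) a - p (n + 1) a| := by
      calc ∑ a, softmax τ (x n) a * ρ a = ∑ a, (softmax τ (x n) a - p (n + 1) a) * ρ a := by
            simp only [sub_mul, Finset.sum_sub_distrib, hz, sub_zero]
        _ ≤ ∑ a, 2 * U * |softmax τ (x n) a - p (n + 1) a| :=
            Finset.sum_le_sum fun a _ => by
              refine (le_abs_self _).trans ?_
              rw [abs_mul, mul_comm]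
              exact mul_le_mul_of_nonneg_right (hle a) (abs_nonneg _)
        _ = _ := by rw [Finset.mul_sum]
    have := softMaximum_add_le hτ (x n) ρ hosc
    rw [hs, Finset.sum_Icc_succ_top (by omega), Nat.add_sub_cancel]
    have e : (2 * U) ^ 2 / (2 * τ) = 2 * U ^ 2 / τ := by field_simp
    rw [e] at this
    push_cast
    linarith

end Hedge

namespace ZeroSumEFG

/-! ### Products of move weights along histories. -/

section Paths

variable {𝒜 : Type*}

theorem pathProd_append (w : List 𝒜 → 𝒜 → ℝ) (h l l' : List 𝒜) :
    pathProd w h (l ++ l') = pathProd w h l * pathProd w (h ++ l) l' := by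
  induction l generalizing h with
  | nil => simp [pathProd]
  | cons a l ih => simp [pathProd, ih, mul_assoc]

theorem pathProd_concat (w : List 𝒜 → 𝒜 → ℝ) (h : List 𝒜) (a : 𝒜) :
    pathProd w [] (h ++ [a]) = pathProd w [] h * w h a := by
  simp [pathProd_append, pathProd]

theorem pathProd_mul (v w : List 𝒜 → 𝒜 → ℝ) (h l : List 𝒜) :
    pathProd (fun h a => v h a * w h a) h l = pathProd v h l * pathProd w h l := by
  induction l generalizing h with
  | nil => simp [pathProd]
  | cons a l ih => simp only [pathProd, ih]; ring

variable [DecidableEq 𝒜]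

theorem reach_append (w : List 𝒜 → 𝒜 → ℝ) (h l : List 𝒜) :
    reach w h (h ++ l) = pathProd w h l := by
  simp [reach]

@[simp]
theorem reach_nil_left (w : List 𝒜 → 𝒜 → ℝ) (z : List 𝒜) : reach w [] z = pathProd w [] z := by
  simp [reach]

theorem reach_eq_zero {w : List 𝒜 → 𝒜 → ℝ} {h z : List 𝒜} (hz : ¬ h <+: z) :
    reach w h z = 0 := by
  simp [reach, hz]

theorem reach_self (w : List 𝒜 → 𝒜 → ℝ) (h : List 𝒜) : reach w h h = 1 := by
  simp [reach, pathProd]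

/-- The excluded case is exceptional because `reach w h h = 1`, whereas a proper prefix of `h` is
reached from `h` with weight `0`. -/
theorem reach_concat (w : List 𝒜 → 𝒜 → ℝ) {h z : List 𝒜} {b : 𝒜} (hz : h ≠ z ++ [b]) :
    reach w h (z ++ [b]) = reach w h z * w z b := by
  by_cases hp : h <+: z
  · obtain ⟨l, rfl⟩ := hp
    rw [List.append_assoc, reach_append, reach_append, pathProd_append]
    simp [pathProd]
  · rw [reach_eq_zero hp, zero_mul, reach_eq_zero]
    rw [List.prefix_concat_iff]
    tauto

variable [Fintype 𝒜] {S : Fin 2 → Type*}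

theorem mem_hist_of_prefix (G : ZeroSumEFG 𝒜 S) {h z : List 𝒜} (hz : z ∈ G.hist) (hp : h <+: z) :
    h ∈ G.hist := by
  obtain ⟨l, rfl⟩ := hp
  induction l using List.reverseRecOn with
  | nil => simpa using hz
  | append_singleton l a ih => exact ih (G.prefix_mem _ a (by simpa using hz))

theorem mem_available {H : Finset (List 𝒜)} {h : List 𝒜} {a : 𝒜} :
    a ∈ available H h ↔ h ++ [a] ∈ H := by
  simp [available]

/-- Telescoping along `z`: follow `v` up to `h`, switch at the move `a`, and continue with `w`. Only
pairs with `h ++ [a]` a prefix of `z` contribute. -/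
theorem pathProd_sub_pathProd (G : ZeroSumEFG 𝒜 S) (v w : List 𝒜 → 𝒜 → ℝ) {z : List 𝒜}
    (hz : z ∈ G.hist) :
    pathProd v [] z - pathProd w [] z =
      ∑ h ∈ G.hist, ∑ a, pathProd v [] h * (v h a - w h a) * reach w (h ++ [a]) z := by
  induction z using List.reverseRecOn with
  | nil =>
    rw [Finset.sum_eq_zero]
    · simp [pathProd]
    · exact fun h _ => Finset.sum_eq_zero fun a _ => by rw [reach_eq_zero (by simp), mul_zero]
  | append_singleton z b ih =>
    have hz' := G.prefix_mem z b hz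
    -- Appending `b` multiplies all old terms by `w z b` and creates one new term, at the pair `(z,
    -- b)`.
    have e : ∀ h a, pathProd v [] h * (v h a - w h a) * reach w (h ++ [a]) (z ++ [b]) =
        pathProd v [] h * (v h a - w h a) * reach w (h ++ [a]) z * w z b +
          if h = z then (if a = b then pathProd v [] z * (v z b - w z b) else 0) else 0 := by
      intro h a
      by_cases hh : h ++ [a] = z ++ [b]
      · obtain ⟨rfl, h2⟩ := List.append_inj' hh rfl
        obtain rfl : a = b := by simpa using h2
        rw [reach_self, reach_eq_zero (z := h) (fun hp => by simpa using hp.length_le)]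
        simp
      · rw [reach_concat w hh, ← ite_and, if_neg (by rintro ⟨rfl, rfl⟩; exact hh rfl)]
        ring
    simp only [e, Finset.sum_add_distrib, ← Finset.sum_mul]
    rw [← ih hz', pathProd_concat, pathProd_concat]
    simp only [Finset.sum_ite_irrel, Finset.sum_ite_eq', Finset.mem_univ, Finset.sum_const_zero,
      if_true, hz']
    ring

theorem pathProd_nonneg (G : ZeroSumEFG 𝒜 S) {w : List 𝒜 → 𝒜 → ℝ}
    (hw : ∀ h a, h ++ [a] ∈ G.hist → 0 ≤ w h a) {z : List 𝒜} (hz : z ∈ G.hist) :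
    0 ≤ pathProd w [] z := by
  induction z using List.reverseRecOn with
  | nil => simp [pathProd]
  | append_singleton z b ih =>
    rw [pathProd_concat]
    exact mul_nonneg (ih (G.prefix_mem z b hz)) (hw z b hz)

theorem exists_terminal (G : ZeroSumEFG 𝒜 S) : G.terminals.Nonempty := by
  obtain ⟨z, hz, hmax⟩ := G.hist.exists_max_image List.length ⟨[], G.nil_mem⟩
  refine ⟨z, Finset.mem_filter.2 ⟨hz, Finset.eq_empty_of_forall_notMem fun a ha => ?_⟩⟩
  have := hmax _ (mem_available.1 ha)
  simp at this

/-- The mass already absorbed at terminal histories plus the mass at depth `n` does not increase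
with `n`. The inequality in `hw1` leaves room for weights that lose mass, such as `followStep`. -/
theorem sum_pathProd_terminals_le_one (G : ZeroSumEFG 𝒜 S) {w : List 𝒜 → 𝒜 → ℝ}
    (hw : ∀ h a, h ++ [a] ∈ G.hist → 0 ≤ w h a)
    (hw1 : ∀ h ∈ G.hist, (available G.hist h).Nonempty → ∑ a ∈ available G.hist h, w h a ≤ 1) :
    ∑ z ∈ G.terminals, pathProd w [] z ≤ 1 := by
  have key : ∀ n : ℕ, ∑ z ∈ G.terminals.filter (fun z => z.length < n), pathProd w [] z +
      ∑ h ∈ G.hist.filter (fun h => h.length = n), pathProd w [] h ≤ 1 := by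
    intro n
    induction n with
    | zero =>
      have : G.hist.filter (fun h => h.length = 0) = {[]} := by
        ext h
        simp only [Finset.mem_filter, List.length_eq_zero_iff, Finset.mem_singleton]
        exact ⟨fun h => h.2, fun h => ⟨h ▸ G.nil_mem, h⟩⟩
      rw [this]
      simp [pathProd]
    | succ n ih =>
      refine le_trans ?_ ih
      have h1 : ∑ z ∈ G.terminals.filter (fun z => z.length < n + 1), pathProd w [] z =
          ∑ z ∈ G.terminals.filter (fun z => z.length < n), pathProd w [] z +
          ∑ z ∈ G.hist.filter (fun h => h.length = n),
            if available G.hist z = ∅ then pathProd w [] z else 0 := by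
        rw [← Finset.sum_filter, Finset.filter_filter, terminals, Finset.filter_filter,
          Finset.filter_filter, ← Finset.sum_union]
        · refine Finset.sum_congr ?_ fun _ _ => rfl
          ext z
          simp only [Finset.mem_filter, Finset.mem_union, Nat.lt_succ_iff_lt_or_eq]
          tauto
        · rw [Finset.disjoint_left]
          intro z hz hz'
          simp only [Finset.mem_filter] at hz hz'
          omega
      have h2 : ∑ h ∈ G.hist.filter (fun h => h.length = n + 1), pathProd w [] h =
          ∑ h ∈ G.hist.filter (fun h => h.length = n), ∑ a ∈ available G.hist h,
            pathProd w [] h * w h a := by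
        rw [Finset.sum_sigma']
        symm
        refine Finset.sum_bij (fun x _ => x.1 ++ [x.2]) ?_ ?_ ?_ ?_
        · rintro ⟨h, a⟩ hx
          simp only [Finset.mem_sigma, Finset.mem_filter, mem_available] at hx
          simp [hx.2, hx.1.2]
        · rintro ⟨h, a⟩ _ ⟨h', a'⟩ _ he
          obtain ⟨rfl, h2⟩ := List.append_inj' he rfl
          obtain rfl : a = a' := by simpa using h2
          rfl
        · intro z hz
          simp only [Finset.mem_filter] at hz
          rcases List.eq_nil_or_concat' z with rfl | ⟨h, a, rfl⟩
          · simp at hz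
          · exact ⟨⟨h, a⟩, by
              simpa [mem_available, hz.1] using ⟨G.prefix_mem _ _ hz.1, by simpa using hz.2⟩, rfl⟩
        · rintro ⟨h, a⟩ _
          rw [pathProd_concat]
      rw [h1, h2, add_assoc, ← Finset.sum_add_distrib]
      gcongr with h hh
      have hh' := (Finset.mem_filter.1 hh).1
      rw [← Finset.mul_sum]
      have h0 := G.pathProd_nonneg hw hh'
      split_ifs with he
      · simp [he]
      · rw [zero_add]
        exact mul_le_of_le_one_right h0 (hw1 h hh' (Finset.nonempty_iff_ne_empty.2 he))
  -- Beyond the length of the longest history every terminal history has been counted.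
  refine le_trans ?_ (key (G.hist.sup List.length + 1))
  have : G.terminals.filter (fun z => z.length < G.hist.sup List.length + 1) = G.terminals :=
    Finset.filter_true_of_mem fun z hz =>
      Nat.lt_succ_of_le (Finset.le_sup (f := List.length) (Finset.mem_filter.1 hz).1)
  rw [this]
  exact le_add_of_nonneg_right
    (Finset.sum_nonneg fun h hh => G.pathProd_nonneg hw (Finset.mem_filter.1 hh).1)

end Paths

/-! ### Own reach probabilities and the counterfactual decomposition. -/

section Game

variable {𝒜 : Type*} [Fintype 𝒜] [DecidableEq 𝒜] {S : Fin 2 → Type*} (G : ZeroSumEFG 𝒜 S)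

theorem mem_infoSet [∀ i, DecidableEq (S i)] {i : Fin 2} {s : S i} {h : List 𝒜} :
    h ∈ G.infoSet i s ↔
      h ∈ G.hist ∧ (available G.hist h).Nonempty ∧ G.turn h = some ⟨i, s⟩ := by
  simp [infoSet]

theorem ownSeq_append (i : Fin 2) (h l l' : List 𝒜) :
    G.ownSeq i h (l ++ l') = G.ownSeq i h l ++ G.ownSeq i (h ++ l) l' := by
  induction l generalizing h with
  | nil => simp [ownSeq]
  | cons a l ih => simp [ownSeq, ih]

theorem ownSeq_concat_of_turn {i : Fin 2} {s : S i} {h : List 𝒜} (ht : G.turn h = some ⟨i, s⟩)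
    (a : 𝒜) : G.ownSeq i [] (h ++ [a]) = G.ownSeq i [] h ++ [(⟨i, s⟩, a)] := by
  simp [ownSeq_append, ownSeq, ht]

theorem exists_turn_eq {i : Fin 2} {h : List 𝒜} (ht : (G.turn h).map Sigma.fst = some i) :
    ∃ s : S i, G.turn h = some ⟨i, s⟩ := by
  rcases hh : G.turn h with _ | ⟨j, s⟩
  · simp [hh] at ht
  · simp only [hh, Option.map_some, Option.some.injEq] at ht
    subst ht
    exact ⟨s, rfl⟩

/-- The probability that `σ` assigns to an action at an information state. -/
def moveWeight (σ : G.Profile) (x : (Σ i, S i) × 𝒜) : ℝ :=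
  if ha : x.2 ∈ G.acts x.1.1 x.1.2 then (σ x.1.1 x.1.2).1 ⟨x.2, ha⟩ else 0

theorem moveWeight_nonneg (σ : G.Profile) (x : (Σ i, S i) × 𝒜) : 0 ≤ G.moveWeight σ x := by
  unfold moveWeight
  split_ifs
  · exact (σ x.1.1 x.1.2).2.1 _
  · exact le_rfl

theorem policy_le_one {i : Fin 2} {s : S i} (p : stdSimplex ℝ (G.acts i s)) (a : G.acts i s) :
    p.1 a ≤ 1 :=
  (Finset.single_le_sum (fun b _ => p.2.1 b) (Finset.mem_univ a)).trans_eq p.2.2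

theorem moveWeight_le_one (σ : G.Profile) (x : (Σ i, S i) × 𝒜) : G.moveWeight σ x ≤ 1 := by
  unfold moveWeight
  split_ifs
  · exact G.policy_le_one _ _
  · exact zero_le_one

theorem stepProb_of_turn (σ : G.Profile) {i : Fin 2} {s : S i} {h : List 𝒜}
    (ht : G.turn h = some ⟨i, s⟩) (a : 𝒜) : G.stepProb σ h a = G.moveWeight σ (⟨i, s⟩, a) := by
  simp [stepProb, ht, moveWeight]

theorem ownStep_of_turn (σ : G.Profile) {i : Fin 2} {s : S i} {h : List 𝒜}
    (ht : G.turn h = some ⟨i, s⟩) (a : 𝒜) : G.ownStep i σ h a = G.moveWeight σ (⟨i, s⟩, a) := by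
  simp [ownStep, ht, G.stepProb_of_turn σ ht]

theorem ownStep_of_ne (σ : G.Profile) {i : Fin 2} {h : List 𝒜}
    (ht : (G.turn h).map Sigma.fst ≠ some i) (a : 𝒜) : G.ownStep i σ h a = 1 := by
  simp [ownStep, ht]

theorem moveWeight_congr {σ σ' : G.Profile} {i : Fin 2} (h : σ i = σ' i) (s : S i) (a : 𝒜) :
    G.moveWeight σ (⟨i, s⟩, a) = G.moveWeight σ' (⟨i, s⟩, a) := by
  simp [moveWeight, h]

theorem ownStep_congr {σ σ' : G.Profile} {i : Fin 2} (h : σ i = σ' i) :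
    G.ownStep i σ = G.ownStep i σ' := by
  funext x a
  by_cases ht : (G.turn x).map Sigma.fst = some i
  · obtain ⟨s, hs⟩ := G.exists_turn_eq ht
    rw [G.ownStep_of_turn σ hs, G.ownStep_of_turn σ' hs, G.moveWeight_congr h]
  · rw [G.ownStep_of_ne σ ht, G.ownStep_of_ne σ' ht]

/-- This is the link to perfect recall: own reach depends on a history only through its `ownSeq`. -/
theorem pathProd_ownStep (i : Fin 2) (σ : G.Profile) (h l : List 𝒜) :
    pathProd (G.ownStep i σ) h l = ((G.ownSeq i h l).map (G.moveWeight σ)).prod := by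
  induction l generalizing h with
  | nil => simp [pathProd, ownSeq]
  | cons a l ih =>
    rw [pathProd, ih, ownSeq, List.map_append, List.prod_append]
    congr 1
    by_cases ht : (G.turn h).map Sigma.fst = some i
    · obtain ⟨s, hs⟩ := G.exists_turn_eq ht
      simp [G.ownStep_of_turn σ hs, hs]
    · rw [G.ownStep_of_ne σ ht]
      rcases hh : G.turn h with _ | ⟨j, s⟩
      · simp
      · simp only [hh, Option.map_some, Option.some.injEq] at ht
        simp [ht]

theorem pathProd_ownStep_nonneg (i : Fin 2) (σ : G.Profile) (h l : List 𝒜) :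
    0 ≤ pathProd (G.ownStep i σ) h l := by
  rw [pathProd_ownStep]
  refine List.prod_nonneg fun x hx => ?_
  obtain ⟨y, -, rfl⟩ := List.mem_map.1 hx
  exact G.moveWeight_nonneg σ y

theorem pathProd_ownStep_le_one (i : Fin 2) (σ : G.Profile) (h l : List 𝒜) :
    pathProd (G.ownStep i σ) h l ≤ 1 := by
  rw [pathProd_ownStep]
  induction G.ownSeq i h l with
  | nil => simp
  | cons x m ih =>
    rw [List.map_cons, List.prod_cons]
    refine mul_le_one₀ (G.moveWeight_le_one σ x) (List.prod_nonneg fun z hz => ?_) ih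
    obtain ⟨y, -, rfl⟩ := List.mem_map.1 hz
    exact G.moveWeight_nonneg σ y

theorem ownStep_mul_otherStep (i : Fin 2) (σ : G.Profile) :
    (fun h a => G.ownStep i σ h a * G.otherStep i σ h a) = G.stepProb σ := by
  funext h a
  unfold ownStep otherStep
  split_ifs <;> simp

theorem pathProd_stepProb (i : Fin 2) (σ : G.Profile) (h l : List 𝒜) :
    pathProd (G.stepProb σ) h l =
      pathProd (G.ownStep i σ) h l * pathProd (G.otherStep i σ) h l := by
  rw [← pathProd_mul, ownStep_mul_otherStep]

/-- The contribution of chance to `stepProb`. -/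
def chanceStep (h : List 𝒜) (a : 𝒜) : ℝ :=
  if G.turn h = none then G.chance h a else 1

theorem otherStep_eq {i j : Fin 2} (hij : i ≠ j) (σ : G.Profile) :
    G.otherStep i σ = fun h a => G.ownStep j σ h a * G.chanceStep h a := by
  funext h a
  rcases ht : G.turn h with _ | ⟨k, s⟩
  · simp [otherStep, ownStep, chanceStep, stepProb, ht]
  · by_cases hk : k = i
    · subst hk
      simp [otherStep, ownStep, chanceStep, ht, hij]
    · have : k = j := by omega
      subst this
      simp [otherStep, ownStep, chanceStep, ht, hk]

theorem pathProd_otherStep {i j : Fin 2} (hij : i ≠ j) (σ : G.Profile) (h l : List 𝒜) :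
    pathProd (G.otherStep i σ) h l =
      pathProd (G.ownStep j σ) h l * pathProd G.chanceStep h l := by
  rw [G.otherStep_eq hij, pathProd_mul]

theorem otherStep_congr {σ σ' : G.Profile} {i j : Fin 2} (hij : i ≠ j) (h : σ j = σ' j) :
    G.otherStep i σ = G.otherStep i σ' := by
  rw [G.otherStep_eq hij, G.otherStep_eq hij, G.ownStep_congr h]

theorem exists_ne_player (i : Fin 2) : ∃ j : Fin 2, i ≠ j := ⟨i + 1, by omega⟩

theorem otherStep_update (σ : G.Profile) (i : Fin 2) (π : G.Policy i) :
    G.otherStep i (Function.update σ i π) = G.otherStep i σ := by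
  obtain ⟨j, hij⟩ := exists_ne_player i
  exact G.otherStep_congr hij (Function.update_of_ne hij.symm _ _)

theorem available_nonempty {h : List 𝒜} {a : 𝒜} (ha : h ++ [a] ∈ G.hist) :
    (available G.hist h).Nonempty :=
  ⟨a, mem_available.2 ha⟩

theorem stepProb_nonneg (σ : G.Profile) {h : List 𝒜} {a : 𝒜} (ha : h ++ [a] ∈ G.hist) :
    0 ≤ G.stepProb σ h a := by
  rcases ht : G.turn h with _ | ⟨k, s⟩
  · simp only [stepProb, ht]
    exact G.chance_nonneg h (G.prefix_mem h a ha) (G.available_nonempty ha) ht a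
      (mem_available.2 ha)
  · rw [G.stepProb_of_turn σ ht]
    exact G.moveWeight_nonneg _ _

theorem otherStep_nonneg (i : Fin 2) (σ : G.Profile) {h : List 𝒜} {a : 𝒜}
    (ha : h ++ [a] ∈ G.hist) : 0 ≤ G.otherStep i σ h a := by
  unfold otherStep
  split_ifs
  · exact zero_le_one
  · exact G.stepProb_nonneg σ ha

theorem sum_moveWeight (σ : G.Profile) {i : Fin 2} (s : S i) (f : 𝒜 → ℝ) :
    ∑ a, G.moveWeight σ (⟨i, s⟩, a) * f a = ∑ a : G.acts i s, (σ i s).1 a * f a.1 := by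
  rw [← Finset.sum_subset (Finset.subset_univ (G.acts i s))
    (fun a _ ha => by simp [moveWeight, ha]), ← Finset.sum_coe_sort]
  exact Finset.sum_congr rfl fun a _ => by simp [moveWeight]

theorem sum_stepProb (σ : G.Profile) {h : List 𝒜} (hh : h ∈ G.hist)
    (hn : (available G.hist h).Nonempty) : ∑ a ∈ available G.hist h, G.stepProb σ h a = 1 := by
  rcases ht : G.turn h with _ | ⟨k, s⟩
  · simp only [stepProb, ht]
    exact G.chance_sum h hh hn ht
  · rw [G.available_eq k s h hh hn ht, ← (σ k s).2.2, ← Finset.sum_coe_sort]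
    exact Finset.sum_congr rfl fun a _ => by simp [G.stepProb_of_turn σ ht, moveWeight]

theorem value_eq (i : Fin 2) (σ : G.Profile) :
    G.value i σ = ∑ z ∈ G.terminals, pathProd (G.ownStep i σ) [] z *
      (pathProd (G.otherStep i σ) [] z * G.reward i z) := by
  simp only [value, reach_nil_left, G.pathProd_stepProb i, mul_assoc]

variable [∀ i, DecidableEq (S i)]

/-- Under perfect recall all histories of an information state have the same own reach
probability, which depends only on the policy of the player. -/
theorem exists_own_reach (hG : G.PerfectRecall) (i : Fin 2) (π : G.Policy i) :
    ∃ η : S i → ℝ, (∀ s, 0 ≤ η s ∧ η s ≤ 1) ∧ ∀ σ : G.Profile, σ i = π →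
      ∀ s, ∀ h ∈ G.infoSet i s, pathProd (G.ownStep i σ) [] h = η s := by
  classical
  have hne : ∀ s, ∃ h, h ∈ G.infoSet i s := fun s => by
    obtain ⟨h, h1, h2, h3⟩ := G.info_nonempty i s
    exact ⟨h, G.mem_infoSet.2 ⟨h1, h2, h3⟩⟩
  choose h₀ h₀_mem using hne
  -- The other player's policy is irrelevant here; `normalize` of the zero vector serves as an
  -- arbitrary distribution.
  let σ₀ : G.Profile := Function.update
    (fun i s => haveI := (G.acts_nonempty i s).to_subtype; normalize fun _ => 0) i π
  refine ⟨fun s => pathProd (G.ownStep i σ₀) [] (h₀ s), fun s =>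
    ⟨G.pathProd_ownStep_nonneg _ _ _ _, G.pathProd_ownStep_le_one _ _ _ _⟩, ?_⟩
  intro σ hσ s h hh
  rw [G.ownStep_congr (show σ i = σ₀ i by simp [σ₀, hσ])]
  simp only [pathProd_ownStep]
  rw [hG i s h hh _ (h₀_mem s)]

variable [∀ i, Fintype (S i)]

theorem sum_hist_eq_sum_infoSet (i : Fin 2) (F : List 𝒜 → ℝ)
    (hF : ∀ h ∈ G.hist, available G.hist h = ∅ ∨ (G.turn h).map Sigma.fst ≠ some i → F h = 0) :
    ∑ h ∈ G.hist, F h = ∑ s : S i, ∑ h ∈ G.infoSet i s, F h := by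
  simp only [infoSet, Finset.sum_filter]
  rw [Finset.sum_comm]
  refine Finset.sum_congr rfl fun h hh => ?_
  by_cases hc : available G.hist h = ∅ ∨ (G.turn h).map Sigma.fst ≠ some i
  · simp [hF h hh hc]
  · push Not at hc
    obtain ⟨s₀, hs₀⟩ := G.exists_turn_eq hc.2
    rw [Finset.sum_eq_single s₀]
    · rw [if_pos ⟨hc.1, hs₀⟩]
    · rintro s - hs
      refine if_neg fun h' => hs ?_
      simpa [hs₀] using h'.2.symm
    · simp

/-- The gain of a deviation is a combination of instantaneous counterfactual regrets. -/
theorem value_update_sub_value (σ : G.Profile) (i : Fin 2) (π : G.Policy i) (η : S i → ℝ)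
    (hη : ∀ s, ∀ h ∈ G.infoSet i s,
      pathProd (G.ownStep i (Function.update σ i π)) [] h = η s) :
    G.value i (Function.update σ i π) - G.value i σ =
      ∑ s, η s * ∑ a, (π s).1 a * G.cfRegret σ i s a := by
  set σ' := Function.update σ i π with hσ'
  -- The contribution of a single history to `cfValue`; summing it over an information state gives
  -- the counterfactual value.
  set C : List 𝒜 → 𝒜 → ℝ := fun h a => ∑ z ∈ G.terminals,
    reach (G.ownStep i σ) (h ++ [a]) z * reach (G.otherStep i σ) [] z * G.reward i z with hC
  have h1 : G.value i σ' - G.value i σ = ∑ h ∈ G.hist, ∑ a,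
      pathProd (G.ownStep i σ') [] h * (G.ownStep i σ' h a - G.ownStep i σ h a) * C h a := by
    rw [value_eq, value_eq, hσ', otherStep_update, ← hσ', ← Finset.sum_sub_distrib]
    simp only [hC, Finset.mul_sum]
    rw [Finset.sum_congr rfl fun h _ => Finset.sum_comm, Finset.sum_comm]
    refine Finset.sum_congr rfl fun z hz => ?_
    rw [← sub_mul, G.pathProd_sub_pathProd _ _ (Finset.mem_filter.1 hz).1, Finset.sum_mul]
    refine Finset.sum_congr rfl fun h _ => ?_
    rw [Finset.sum_mul]
    refine Finset.sum_congr rfl fun a _ => ?_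
    rw [reach_nil_left]
    ring
  rw [h1, G.sum_hist_eq_sum_infoSet i]
  · refine Finset.sum_congr rfl fun s _ => ?_
    have h2 : ∀ h ∈ G.infoSet i s, ∑ a, pathProd (G.ownStep i σ') [] h *
        (G.ownStep i σ' h a - G.ownStep i σ h a) * C h a =
        η s * ∑ a : G.acts i s, ((π s).1 a - (σ i s).1 a) * C h a.1 := by
      intro h hh
      have ht := (G.mem_infoSet.1 hh).2.2
      simp only [hη s h hh, G.ownStep_of_turn _ ht, mul_assoc, ← Finset.mul_sum, sub_mul,
        Finset.sum_sub_distrib, sum_moveWeight]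
      simp [hσ']
    rw [Finset.sum_congr rfl h2, ← Finset.mul_sum, Finset.sum_comm]
    congr 1
    simp only [← Finset.mul_sum]
    change ∑ a, ((π s).1 a - (σ i s).1 a) * G.cfValue σ i s a = _
    simp only [cfRegret, mul_sub, sub_mul, Finset.sum_sub_distrib, ← Finset.sum_mul, (π s).2.2,
      one_mul]
  · intro h hh hc
    refine Finset.sum_eq_zero fun a _ => ?_
    -- At a terminal `h` nothing extends `h ++ [a]`; where player `i` does not move, both own
    -- weights are `1` and their difference vanishes.
    rcases hc with hc | hc
    · have : C h a = 0 := by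
        refine Finset.sum_eq_zero fun z hz => ?_
        rw [reach_eq_zero, zero_mul, zero_mul]
        intro hp
        have := mem_available.2 (G.mem_hist_of_prefix (Finset.mem_filter.1 hz).1 hp)
        simp [hc] at this
      rw [this, mul_zero]
    · rw [G.ownStep_of_ne _ hc, G.ownStep_of_ne _ hc]
      simp

end Game

/-! ### Average policies, equilibrium, and the bound on counterfactual values. -/

section Bounds

theorem normalize_apply {A : Type*} [Fintype A] [Nonempty A] {w : A → ℝ} (h0 : ∀ a, 0 ≤ w a)
    (hs : 0 < ∑ a, w a) (a : A) : (normalize w).1 a = w a / ∑ b, w b := by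
  rw [normalize, dif_pos ⟨h0, hs⟩]

variable {𝒜 : Type*} [Fintype 𝒜] [DecidableEq 𝒜] {S : Fin 2 → Type*} (G : ZeroSumEFG 𝒜 S)

theorem value_eq_neg {i j : Fin 2} (hij : i ≠ j) (σ : G.Profile) :
    G.value j σ = -G.value i σ := by
  simp only [value, ← Finset.sum_neg_distrib]
  refine Finset.sum_congr rfl fun z _ => ?_
  have : G.reward j z = -G.reward i z := by
    by_cases hi : i = 0
    · have hj : j ≠ 0 := fun h => hij (hi.trans h.symm)
      simp [reward, hi, hj]
    · have hj : j = 0 := by omega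
      simp [reward, hi, hj]
  rw [this, mul_neg]

variable [∀ i, DecidableEq (S i)]

/-- The average policy at a state weights each `σ k` by its own reach of that state, so its
denominator cancels the averaged reach of the parent history. -/
theorem pathProd_avgProfile (hG : G.PerfectRecall) (σ : ℕ → G.Profile) {t : ℕ} (ht : 1 ≤ t)
    (j : Fin 2) {h : List 𝒜} (hh : h ∈ G.hist) :
    pathProd (G.ownStep j (G.avgProfile σ t)) [] h =
      1 / t * ∑ k ∈ Finset.Icc 1 t, pathProd (G.ownStep j (σ k)) [] h := by
  have ht0 : (t : ℝ) ≠ 0 := by positivity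
  induction h using List.reverseRecOn with
  | nil => simp [pathProd, ht0]
  | append_singleton h a ih =>
    have ih := ih (G.prefix_mem h a hh)
    simp only [pathProd_concat]
    by_cases hc : (G.turn h).map Sigma.fst = some j
    · obtain ⟨s, hs⟩ := G.exists_turn_eq hc
      have hn := G.available_nonempty hh
      have hmem : h ∈ G.infoSet j s := G.mem_infoSet.2 ⟨G.prefix_mem h a hh, hn, hs⟩
      have ha : a ∈ G.acts j s := by
        rw [← G.available_eq j s h (G.prefix_mem h a hh) hn hs]
        exact mem_available.2 hh
      have hstep : ∀ ρ : G.Profile, G.ownStep j ρ h a = (ρ j s).1 ⟨a, ha⟩ := fun ρ => by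
        simp [G.ownStep_of_turn ρ hs, moveWeight, ha]
      simp only [hstep]
      rw [ih, mul_assoc]
      congr 1
      set P : ℕ → ℝ := fun k => pathProd (G.ownStep j (σ k)) [] h with hP
      have hP0 : ∀ k, 0 ≤ P k := fun k => G.pathProd_ownStep_nonneg _ _ _ _
      -- By perfect recall all histories of the state carry the same weight, so their number `N`
      -- cancels in the normalization.
      set N : ℝ := ((G.infoSet j s).card : ℝ)
      have hN0 : 0 < N := Nat.cast_pos.2 (Finset.card_pos.2 ⟨h, hmem⟩)
      have hw : ∀ b, ∑ k ∈ Finset.Icc 1 t, ∑ h' ∈ G.infoSet j s,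
          reach (G.ownStep j (σ k)) [] h' * (σ k j s).1 b =
          N * ∑ k ∈ Finset.Icc 1 t, P k * (σ k j s).1 b := fun b => by
        rw [Finset.mul_sum]
        refine Finset.sum_congr rfl fun k _ => ?_
        have : ∀ h' ∈ G.infoSet j s, reach (G.ownStep j (σ k)) [] h' * (σ k j s).1 b =
            P k * (σ k j s).1 b := fun h' hh' => by
          rw [reach_nil_left, hP, pathProd_ownStep, hG j s h' hh' h hmem, ← pathProd_ownStep]
        rw [Finset.sum_congr rfl this, Finset.sum_const, nsmul_eq_mul]
      have hsum : ∑ b, N * ∑ k ∈ Finset.Icc 1 t, P k * (σ k j s).1 b =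
          N * ∑ k ∈ Finset.Icc 1 t, P k := by
        rw [← Finset.mul_sum, Finset.sum_comm]
        congr 1
        refine Finset.sum_congr rfl fun k _ => ?_
        rw [← Finset.mul_sum, (σ k j s).2.2, mul_one]
      change (∑ k ∈ Finset.Icc 1 t, P k) * _ = ∑ k ∈ Finset.Icc 1 t, P k * _
      -- If the total weight is zero, `normalize` takes its default value, but then every `P k` is
      -- zero and so are both sides.
      rcases (Finset.sum_nonneg fun k (_ : k ∈ Finset.Icc 1 t) => hP0 k).eq_or_lt with h0 | h0
      · rw [← h0, zero_mul, Finset.sum_eq_zero]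
        intro k hk
        rw [(Finset.sum_eq_zero_iff_of_nonneg fun k _ => hP0 k).1 h0.symm k hk, zero_mul]
      · have := (G.acts_nonempty j s).to_subtype
        simp only [avgProfile, hw]
        rw [normalize_apply (fun b => mul_nonneg hN0.le (Finset.sum_nonneg fun k _ =>
          mul_nonneg (hP0 k) ((σ k j s).2.1 b))) (hsum.symm ▸ mul_pos hN0 h0), hsum]
        field_simp
    · simp only [G.ownStep_of_ne _ hc, mul_one]
      exact ih

/-- With the policy of `i` fixed, the value is linear in the opponent's own reach probabilities. -/
theorem value_update_avgProfile (hG : G.PerfectRecall) (σ : ℕ → G.Profile) {t : ℕ} (ht : 1 ≤ t)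
    (i : Fin 2) (π : G.Policy i) :
    G.value i (Function.update (G.avgProfile σ t) i π) =
      1 / t * ∑ k ∈ Finset.Icc 1 t, G.value i (Function.update (σ k) i π) := by
  obtain ⟨j, hij⟩ := exists_ne_player i
  simp only [value_eq, otherStep_update, G.pathProd_otherStep hij]
  rw [Finset.sum_comm, Finset.mul_sum]
  refine Finset.sum_congr rfl fun z hz => ?_
  rw [G.pathProd_avgProfile hG σ ht j (Finset.mem_filter.1 hz).1]
  have : ∀ k, G.ownStep i (Function.update (σ k) i π) =
      G.ownStep i (Function.update (G.avgProfile σ t) i π) := fun k =>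
    G.ownStep_congr (by simp)
  simp only [this, Finset.mul_sum, Finset.sum_mul]
  exact Finset.sum_congr rfl fun k _ => by ring

theorem isNash_avgProfile (hG : G.PerfectRecall) (σ : ℕ → G.Profile) {t : ℕ} (ht : 1 ≤ t)
    {ε : Fin 2 → ℝ} (hε : ∀ i (π : G.Policy i), 1 / (t : ℝ) * ∑ k ∈ Finset.Icc 1 t,
      (G.value i (Function.update (σ k) i π) - G.value i (σ k)) ≤ ε i) :
    G.IsNash (G.avgProfile σ t) (ε 0 + ε 1) := by
  intro i π
  obtain ⟨j, hij⟩ := exists_ne_player i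
  have h1 := hε i π
  -- Comparing `j` with its own average policy bounds the average value of the play against the
  -- value of the average profile; by the zero-sum property the average play value cancels when this
  -- is added to `h1`.
  have h2 := hε j (G.avgProfile σ t j)
  rw [Finset.sum_sub_distrib, mul_sub, ← G.value_update_avgProfile hG σ ht] at h1 h2
  rw [Function.update_eq_self, G.value_eq_neg hij, Finset.sum_congr rfl fun k _ =>
    G.value_eq_neg hij (σ k), Finset.sum_neg_distrib] at h2
  have : ε 0 + ε 1 = ε i + ε j := by
    by_cases hi : i = 0
    · obtain rfl : j = 1 := by omega
      rw [hi]
    · obtain rfl : i = 1 := by omega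
      obtain rfl : j = 0 := by omega
      rw [add_comm]
  rw [this]
  linarith

/-- The move weights that make player `i` follow the sequence `Q` as long as it lasts, and the
profile `σ` afterwards. -/
def followStep (i : Fin 2) (σ : G.Profile) (Q : List ((Σ i, S i) × 𝒜)) (h : List 𝒜) (a : 𝒜) : ℝ :=
  if (G.turn h).map Sigma.fst = some i ∧ (G.ownSeq i [] h).length < Q.length then
    if G.ownSeq i [] (h ++ [a]) <+: Q then 1 else 0
  else G.stepProb σ h a

theorem followStep_nonneg (i : Fin 2) (σ : G.Profile) (Q : List ((Σ i, S i) × 𝒜)) {h : List 𝒜}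
    {a : 𝒜} (ha : h ++ [a] ∈ G.hist) : 0 ≤ G.followStep i σ Q h a := by
  unfold followStep
  split_ifs
  · exact zero_le_one
  · exact le_rfl
  · exact G.stepProb_nonneg σ ha

/-- While `Q` is being followed at most one action continues it, and none does once play has left
`Q`; the mass is then lost. -/
theorem sum_followStep_le_one (i : Fin 2) (σ : G.Profile) (Q : List ((Σ i, S i) × 𝒜))
    {h : List 𝒜} (hh : h ∈ G.hist) (hn : (available G.hist h).Nonempty) :
    ∑ a ∈ available G.hist h, G.followStep i σ Q h a ≤ 1 := by
  by_cases hc : (G.turn h).map Sigma.fst = some i ∧ (G.ownSeq i [] h).length < Q.length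
  · simp only [followStep, if_pos hc]
    rw [Finset.sum_boole]
    have : ((available G.hist h).filter fun a => G.ownSeq i [] (h ++ [a]) <+: Q).card ≤ 1 := by
      rw [Finset.card_le_one]
      intro a ha b hb
      obtain ⟨s, hs⟩ := G.exists_turn_eq hc.1
      have ha := (Finset.mem_filter.1 ha).2
      have hb := (Finset.mem_filter.1 hb).2
      rw [G.ownSeq_concat_of_turn hs] at ha hb
      have := (List.prefix_of_prefix_length_le ha hb (by simp)).eq_of_length (by simp)
      simpa using this
    exact_mod_cast this
  · simp only [followStep, if_neg hc]
    exact (G.sum_stepProb σ hh hn).le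

theorem pathProd_followStep_of_prefix (i : Fin 2) (σ : G.Profile) {Q : List ((Σ i, S i) × 𝒜)}
    {x : List 𝒜} (hx : G.ownSeq i [] x <+: Q) :
    pathProd (G.followStep i σ Q) [] x = pathProd (G.otherStep i σ) [] x := by
  induction x using List.reverseRecOn with
  | nil => simp [pathProd]
  | append_singleton x b ih =>
    have hpre : G.ownSeq i [] x <+: G.ownSeq i [] (x ++ [b]) := by
      rw [ownSeq_append]
      exact List.prefix_append _ _
    rw [pathProd_concat, pathProd_concat, ih (hpre.trans hx)]
    congr 1
    by_cases hc : (G.turn x).map Sigma.fst = some i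
    · obtain ⟨s, hs⟩ := G.exists_turn_eq hc
      have hl : (G.ownSeq i [] x).length < Q.length := by
        have := hx.length_le
        rw [G.ownSeq_concat_of_turn hs] at this
        simpa [Nat.succ_le_iff] using this
      rw [followStep, if_pos ⟨hc, hl⟩, if_pos hx, otherStep, if_pos hc]
    · rw [followStep, if_neg (fun h => hc h.1), otherStep, if_neg hc]

theorem pathProd_followStep_of_length_le (i : Fin 2) (σ : G.Profile)
    {Q : List ((Σ i, S i) × 𝒜)} {x : List 𝒜} (hx : Q.length ≤ (G.ownSeq i [] x).length)
    (l : List 𝒜) :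
    pathProd (G.followStep i σ Q) x l = pathProd (G.stepProb σ) x l := by
  induction l generalizing x with
  | nil => simp [pathProd]
  | cons a l ih =>
    rw [pathProd, pathProd, ih, followStep, if_neg (fun h => absurd h.2 (by omega))]
    rw [ownSeq_append, List.length_append]
    omega

/-- A proper extension of `h` records the visit to `s` in its `ownSeq`, so it cannot share the
`ownSeq` of `h`. -/
theorem infoSet_eq_of_prefix (hG : G.PerfectRecall) {i : Fin 2} {s : S i} {h h' : List 𝒜}
    (hh : h ∈ G.infoSet i s) (hh' : h' ∈ G.infoSet i s) (hp : h <+: h') : h = h' := by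
  obtain ⟨l, rfl⟩ := hp
  have := hG i s _ hh _ hh'
  rw [ownSeq_append, List.self_eq_append_right] at this
  cases l with
  | nil => simp
  | cons a l => simp [ownSeq, (G.mem_infoSet.1 hh).2.2] at this

/-- At most one history of the state has its continuation by `a` as a prefix of `z`. Up to that
point the own moves have weight `1` under `followStep`, afterwards the weights are those of `σ`;
perfect recall makes one `Q` serve the whole state. -/
theorem sum_reach_infoSet_le (hG : G.PerfectRecall) (σ : G.Profile) (i : Fin 2) (s : S i) (a : 𝒜)
    {h₀ : List 𝒜} (h₀_mem : h₀ ∈ G.infoSet i s) {z : List 𝒜} (hz : z ∈ G.hist) :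
    ∑ h ∈ G.infoSet i s,
      reach (G.ownStep i σ) (h ++ [a]) z * pathProd (G.otherStep i σ) [] z ≤
      pathProd (G.followStep i σ (G.ownSeq i [] h₀ ++ [(⟨i, s⟩, a)])) [] z := by
  set Q := G.ownSeq i [] h₀ ++ [((⟨i, s⟩ : Σ i, S i), a)]
  by_cases hex : ∃ h ∈ G.infoSet i s, h ++ [a] <+: z
  · obtain ⟨h, hh, hp⟩ := hex
    rw [Finset.sum_eq_single_of_mem h hh]
    · obtain ⟨l, rfl⟩ := hp
      have hq : G.ownSeq i [] (h ++ [a]) = Q := by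
        rw [G.ownSeq_concat_of_turn (G.mem_infoSet.1 hh).2.2, hG i s h hh h₀ h₀_mem]
      have hq' : Q.length ≤ (G.ownSeq i [] (h ++ [a])).length := by rw [hq]
      rw [reach_append, pathProd_append _ [] (h ++ [a]), pathProd_append _ [] (h ++ [a]),
        List.nil_append,
        G.pathProd_followStep_of_prefix i σ (x := h ++ [a]) (by rw [hq]),
        G.pathProd_followStep_of_length_le i σ hq', G.pathProd_stepProb i]
      exact le_of_eq (by ring)
    · intro h' hh' hne
      rw [reach_eq_zero, zero_mul]
      intro hp'
      have p := (List.prefix_append h [a]).trans hp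
      have p' := (List.prefix_append h' [a]).trans hp'
      rcases List.prefix_or_prefix_of_prefix p p' with q | q
      · exact hne (G.infoSet_eq_of_prefix hG hh hh' q).symm
      · exact hne (G.infoSet_eq_of_prefix hG hh' hh q)
  · push Not at hex
    rw [Finset.sum_eq_zero fun h hh => by rw [reach_eq_zero (hex h hh), zero_mul]]
    exact G.pathProd_nonneg (fun _ _ ha => G.followStep_nonneg i σ Q ha) hz

theorem abs_cfValue_le (hG : G.PerfectRecall) {M : ℝ} (hM : ∀ z ∈ G.terminals, |G.utility z| ≤ M)
    (σ : G.Profile) (i : Fin 2) (s : S i) (a : G.acts i s) : |G.cfValue σ i s a| ≤ M := by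
  obtain ⟨z₀, hz₀⟩ := G.exists_terminal
  have hM0 : 0 ≤ M := (abs_nonneg _).trans (hM z₀ hz₀)
  obtain ⟨h₀, m1, m2, m3⟩ := G.info_nonempty i s
  have h₀_mem : h₀ ∈ G.infoSet i s := G.mem_infoSet.2 ⟨m1, m2, m3⟩
  set Q := G.ownSeq i [] h₀ ++ [((⟨i, s⟩ : Σ i, S i), a.1)]
  have hr : ∀ z ∈ G.terminals, |G.reward i z| ≤ M := fun z hz => by
    unfold reward
    split_ifs
    · exact hM z hz
    · rw [abs_neg]
      exact hM z hz
  have hown : ∀ h z, 0 ≤ reach (G.ownStep i σ) h z := fun h z => by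
    unfold reach
    split_ifs
    · exact G.pathProd_ownStep_nonneg _ _ _ _
    · exact le_rfl
  have hoth : ∀ z ∈ G.terminals, 0 ≤ pathProd (G.otherStep i σ) [] z := fun z hz =>
    G.pathProd_nonneg (fun _ _ ha => G.otherStep_nonneg i σ ha) (Finset.mem_filter.1 hz).1
  unfold cfValue
  rw [Finset.sum_comm]
  refine (Finset.abs_sum_le_sum_abs _ _).trans ?_
  calc ∑ z ∈ G.terminals, |∑ h ∈ G.infoSet i s, reach (G.ownStep i σ) (h ++ [a.1]) z *
        reach (G.otherStep i σ) [] z * G.reward i z|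
      ≤ ∑ z ∈ G.terminals, pathProd (G.followStep i σ Q) [] z * M := by
        refine Finset.sum_le_sum fun z hz => ?_
        simp only [reach_nil_left]
        rw [← Finset.sum_mul, abs_mul, abs_of_nonneg
          (Finset.sum_nonneg fun h _ => mul_nonneg (hown _ _) (hoth z hz))]
        have hle := G.sum_reach_infoSet_le hG σ i s a.1 h₀_mem (Finset.mem_filter.1 hz).1
        exact mul_le_mul hle (hr z hz) (abs_nonneg _) (le_trans
          (Finset.sum_nonneg fun h _ => mul_nonneg (hown _ _) (hoth z hz)) hle)
    _ = (∑ z ∈ G.terminals, pathProd (G.followStep i σ Q) [] z) * M := by rw [Finset.sum_mul]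
    _ ≤ M := mul_le_of_le_one_left hM0 (G.sum_pathProd_terminals_le_one
        (fun _ _ ha => G.followStep_nonneg i σ Q ha)
        fun _ hh hn => G.sum_followStep_le_one i σ Q hh hn)

end Bounds

/-! ### Assembling the regret bounds. -/

section Regret

variable {𝒜 : Type*} [Fintype 𝒜] [DecidableEq 𝒜] {S : Fin 2 → Type*} (G : ZeroSumEFG 𝒜 S)
  [∀ i, DecidableEq (S i)]

theorem approxError_nonneg (τ : ℝ) {d : ℕ} (φ : (Σ i, S i) → 𝒜 → EuclideanSpace ℝ (Fin d))
    (y : ℕ → EuclideanSpace ℝ (Fin d) → ℝ) (σ : ℕ → G.Profile) (t : ℕ) (i : Fin 2) (s : S i) :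
    0 ≤ G.approxError τ φ y σ t i s :=
  Finset.sum_nonneg fun _ _ => Finset.sum_nonneg fun _ _ => abs_nonneg _

variable {U : ℝ} (hU : ∀ (σ : G.Profile) (i : Fin 2) (s : S i) (a : G.acts i s),
  |G.cfValue σ i s a| ≤ U) {τ : ℝ} (hτ : 0 < τ) {d : ℕ}
  {φ : (Σ i, S i) → 𝒜 → EuclideanSpace ℝ (Fin d)} {y : ℕ → EuclideanSpace ℝ (Fin d) → ℝ}
  {σ : ℕ → G.Profile} {t : ℕ} {i : Fin 2}

include hU in
theorem bound_nonneg (σ : G.Profile) (s : S i) : 0 ≤ U := by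
  obtain ⟨a, ha⟩ := G.acts_nonempty i s
  exact (abs_nonneg _).trans (hU σ i s ⟨a, ha⟩)

include hU hτ in
theorem cumRegret_le (hσ : G.IsExpRCFR τ φ y σ i) (s : S i) (a : G.acts i s) :
    G.cumRegret σ t i s a ≤ τ * Real.log (G.acts i s).card +
      2 * U * G.approxError τ φ y σ t i s + t * (2 * U ^ 2 / τ) := by
  have := (G.acts_nonempty i s).to_subtype
  have := cumulative_regret_le hτ (fun k => G.cfValue (σ k) i s) (fun k => (σ k i s).1)
    (fun k => G.cumRegret σ k i s) (fun k => hU (σ k) i s) (fun k => (σ k i s).2.1)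
    (fun k => (σ k i s).2.2) (fun k a => rfl) t a
  refine this.trans_eq ?_
  rw [Fintype.card_coe, approxError]
  congr 3
  refine Finset.sum_congr rfl fun k hk => ?_
  -- The policy is prescribed only for `k ≥ 1`, which is exactly the range of the error sum.
  obtain ⟨c, hc⟩ := hσ k (Finset.mem_Icc.1 hk).1 s
  rw [eq_softmax_of_proportional (σ k i s).2.2 hc]

variable [∀ i, Fintype (S i)]

include hU hτ in
theorem average_gain_le (hG : G.PerfectRecall) (ht : 1 ≤ t) (hσ : G.IsExpRCFR τ φ y σ i)
    (π : G.Policy i) :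
    1 / (t : ℝ) * ∑ k ∈ Finset.Icc 1 t,
      (G.value i (Function.update (σ k) i π) - G.value i (σ k)) ≤
      G.regretBound U τ φ y σ t i := by
  have ht0 : (0 : ℝ) < t := by positivity
  obtain ⟨η, hη01, hη⟩ := G.exists_own_reach hG i π
  have h1 : ∀ k, G.value i (Function.update (σ k) i π) - G.value i (σ k) =
      ∑ s, η s * ∑ a, (π s).1 a * G.cfRegret (σ k) i s a := fun k =>
    G.value_update_sub_value (σ k) i π η (hη _ (by simp))
  simp only [h1]
  rw [Finset.sum_comm, Finset.mul_sum, regretBound]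
  refine Finset.sum_le_sum fun s _ => ?_
  set B := τ * Real.log (G.acts i s).card + 2 * U * G.approxError τ φ y σ t i s +
    t * (2 * U ^ 2 / τ) with hB
  have hU0 := G.bound_nonneg hU (σ 0) s
  -- Nonnegativity of `B` allows the coefficient `η s ≤ 1` to be dropped even if the regret itself
  -- is negative.
  have hB0 : 0 ≤ B := by
    have := G.approxError_nonneg τ φ y σ t i s
    have := Real.log_natCast_nonneg (G.acts i s).card
    positivity
  have h2 : ∑ k ∈ Finset.Icc 1 t, η s * ∑ a, (π s).1 a * G.cfRegret (σ k) i s a =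
      η s * ∑ a, (π s).1 a * G.cumRegret σ t i s a := by
    rw [← Finset.mul_sum, Finset.sum_comm]
    simp only [cumRegret, Finset.mul_sum]
  have h3 : ∑ a, (π s).1 a * G.cumRegret σ t i s a ≤ B := by
    calc _ ≤ ∑ a, (π s).1 a * B := Finset.sum_le_sum fun a _ =>
          mul_le_mul_of_nonneg_left (G.cumRegret_le hU hτ hσ s a) ((π s).2.1 a)
      _ = B := by rw [← Finset.sum_mul, (π s).2.2, one_mul]
  have h4 : η s * ∑ a, (π s).1 a * G.cumRegret σ t i s a ≤ B :=
    (mul_le_mul_of_nonneg_left h3 (hη01 s).1).trans (mul_le_of_le_one_left hB0 (hη01 s).2)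
  rw [h2]
  calc _ ≤ 1 / (t : ℝ) * B := mul_le_mul_of_nonneg_left h4 (by positivity)
    _ = _ := by rw [hB]; field_simp

include hU hτ in
theorem extRegret_le (hG : G.PerfectRecall) (ht : 1 ≤ t) (hσ : G.IsExpRCFR τ φ y σ i) :
    1 / (t : ℝ) * G.extRegret σ t i ≤ G.regretBound U τ φ y σ t i := by
  have ht0 : (0 : ℝ) < t := by positivity
  have : Nonempty (G.Pure i) :=
    ⟨fun s => ⟨(G.acts_nonempty i s).choose, (G.acts_nonempty i s).choose_spec⟩⟩
  have : G.extRegret σ t i ≤ t * G.regretBound U τ φ y σ t i := by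
    refine ciSup_le fun p => ?_
    have := G.average_gain_le hU hτ hG ht hσ p.toPolicy
    rwa [one_div, inv_mul_le_iff₀ ht0] at this
  rwa [one_div, inv_mul_le_iff₀ ht0]

include hU hτ in
-- The bound holds state by state. With no information states both sides are `0`, whatever the value
-- of the empty supremum.
theorem regretBound_le (φ : (Σ i, S i) → 𝒜 → EuclideanSpace ℝ (Fin d))
    (y : ℕ → EuclideanSpace ℝ (Fin d) → ℝ) (σ : ℕ → G.Profile) (t : ℕ) (i : Fin 2) :
    G.regretBound U τ φ y σ t i ≤
      Fintype.card (S i) * (1 / (t : ℝ) * (τ * Real.log (Fintype.card 𝒜) +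
        2 * U * ⨆ s : S i, G.approxError τ φ y σ t i s) + 2 * U ^ 2 / τ) := by
  rw [regretBound, ← nsmul_eq_mul, ← Finset.card_univ]
  refine Finset.sum_le_card_nsmul _ _ _ fun s _ => ?_
  have hU0 := G.bound_nonneg hU (σ 0) s
  have h1 : G.approxError τ φ y σ t i s ≤ ⨆ s : S i, G.approxError τ φ y σ t i s :=
    le_ciSup (f := fun s => G.approxError τ φ y σ t i s) (Set.finite_range _).bddAbove s
  have h2 : Real.log (G.acts i s).card ≤ Real.log (Fintype.card 𝒜) :=
    Real.log_le_log (by exact_mod_cast (G.acts_nonempty i s).card_pos)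
      (by exact_mod_cast Finset.card_le_univ _)
  gcongr

end Regret

end ZeroSumEFG

theorem mainTheorem6 {𝒜 : Type*} [Fintype 𝒜] [DecidableEq 𝒜] {S : Fin 2 → Type*}
    [∀ i, Fintype (S i)] [∀ i, DecidableEq (S i)]
    (G : ZeroSumEFG 𝒜 S) (hG : G.PerfectRecall)
    (U : ℝ) (hU : ∀ (σ : G.Profile) (i : Fin 2) (s : S i) (a : G.acts i s),
      |G.cfValue σ i s a| ≤ U)
    (τ : ℝ) (hτ : 0 < τ) {d : ℕ} (φ : (Σ i, S i) → 𝒜 → EuclideanSpace ℝ (Fin d))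
    (y : Fin 2 → ℕ → EuclideanSpace ℝ (Fin d) → ℝ)
    (σ : ℕ → G.Profile) (t : ℕ) (ht : 1 ≤ t) :
    (∀ i, G.IsExpRCFR τ φ (y i) σ i →
      1 / (t : ℝ) * G.extRegret σ t i ≤ G.regretBound U τ φ (y i) σ t i ∧
      G.regretBound U τ φ (y i) σ t i ≤
        Fintype.card (S i) * (1 / (t : ℝ) * (τ * Real.log (Fintype.card 𝒜) +
          2 * U * ⨆ s : S i, G.approxError τ φ (y i) σ t i s) + 2 * U ^ 2 / τ)) ∧
    ((∀ i, G.IsExpRCFR τ φ (y i) σ i) →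
      G.IsNash (G.avgProfile σ t)
        (G.regretBound U τ φ (y 0) σ t 0 + G.regretBound U τ φ (y 1) σ t 1)) ∧
    (∀ M : ℝ, (∀ z ∈ G.terminals, |G.utility z| ≤ M) →
      ∀ (σ' : G.Profile) (i : Fin 2) (s : S i) (a : G.acts i s), |G.cfValue σ' i s a| ≤ M) :=
  ⟨fun i hi => ⟨G.extRegret_le hU hτ hG ht hi, G.regretBound_le hU hτ φ (y i) σ t i⟩,
    fun h => G.isNash_avgProfile hG σ ht (ε := fun i => G.regretBound U τ φ (y i) σ t i)
      fun i π => G.average_gain_le hU hτ hG ht (h i) π,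
    fun _ hM => G.abs_cfValue_le hG hM⟩
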